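/- There is an absolute constant $c>0$ with the following property. Let $n\ge 1$, let $A\in\mathbb{R}^{n\times n}$ be symmetric with $|A_{i,j}|\le 1$ for all $i,j$, let $\epsilon,\delta\in(0,1)$, and let $p\in(0,1]$ satisfy $$p\ \ge\ \frac{c\,\log(n/\delta)}{n\,\epsilon^2}.$$ Let $C\in\mathbb{R}^{n\times n}$ be the random symmetric matrix with $C_{i,i}=A_{i,i}$ for all $i$ and, independently for each pair $i<j$, $$C_{j,i}=C_{i,j}=\begin{cases}\frac1p\,A_{i,j} & \text{with probability } p,\\ 0 & \text{otherwise.}\end{cases}$$ Then with probability at least $1-\delta$ we have $\|A-C\|_2\le \epsilon n$, where $\|\cdot\|_2$ is the spectral norm, and at the same time $|\lambda_k(C)-\lambda_k(A)|\le\epsilon n$ for every $k\in\{1,\dots,n\}$, where $\lambda_1(M)\ge\dots\ge\lambda_n(M)$ denote the eigenvalues of a symmetric matrix $M$ in decreasing order. -/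

import Mathlib

open MeasureTheory ProbabilityTheory

/-- The spectral norm of a real square matrix: the operator norm of `x ↦ M x` with respect to
the Euclidean norm. -/
noncomputable def spectralNorm₂ {n : ℕ} (M : Matrix (Fin n) (Fin n) ℝ) : ℝ :=
  ‖Matrix.toEuclideanCLM (𝕜 := ℝ) M‖

/-- The random matrix `C` on the probability space `(Ω, P)` arises from the square matrix `A` by
symmetric entrywise sampling with probability `p`: the diagonal of `A` is kept, `C` is symmetric,
the entries of `C` above the diagonal are independent, and each such entry equals
`(1 / p) * A i j` with probability `p` and `0` with probability `1 - p`. -/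
structure IsEntrywiseSample {Ω : Type*} [MeasurableSpace Ω] {n : ℕ} (P : Measure Ω)
    (A : Matrix (Fin n) (Fin n) ℝ) (p : unitInterval)
    (C : Ω → Matrix (Fin n) (Fin n) ℝ) : Prop where
  measurable : ∀ i j, Measurable fun ω => C ω i j
  diag : ∀ ω i, C ω i i = A i i
  symm : ∀ ω i j, C ω j i = C ω i j
  law : ∀ i j, i < j →
    HasLaw (fun ω => C ω i j) (bernoulliMeasure (1 / (p : ℝ) * A i j) 0 p) P
  indep : iIndepFun
    (fun (e : {e : Fin n × Fin n // e.1 < e.2}) (ω : Ω) => C ω e.1.1 e.1.2) P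

/-- Every realisation of the sampled matrix is Hermitian. -/
theorem IsEntrywiseSample.isHermitian {Ω : Type*} [MeasurableSpace Ω] {n : ℕ} {P : Measure Ω}
    {A : Matrix (Fin n) (Fin n) ℝ} {p : unitInterval} {C : Ω → Matrix (Fin n) (Fin n) ℝ}
    (h : IsEntrywiseSample P A p C) (ω : Ω) : (C ω).IsHermitian :=
  Matrix.IsHermitian.ext fun i j => by simpa using h.symm ω i j

/-! Moment method. By Weyl's inequality the eigenvalue bound follows from the norm bound, so only
`‖A - C‖` matters. For even powers, its `2k`-th power is at most the trace of `(A - C) ^ (2 * k)`,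
which expands over paths. With `q = 1 / p`, independence and centring kill every path that uses some
edge exactly once. A surviving path with `u + 1` vertices has at least `u` edges, each used twice,
so `u ≤ k` and its expectation is at most `q ^ (2 * k - u)` (`abs_integral_path_le`). Counting paths
by new and old vertices (`sum_paths_weight_le`) gives `n * (9 * n * k * q) ^ k`, and Markov's
inequality with `k ≈ log (n / δ)` concludes. -/

/-! ### Weyl's inequality -/

section Weyl

variable {E : Type*} [NormedAddCommGroup E] [InnerProductSpace ℝ E] [FiniteDimensional ℝ E]

/-- The quadratic form of a symmetric map in terms of its eigenvalues. -/
theorem LinearMap.IsSymmetric.inner_apply_self_eq_sum {T : E →ₗ[ℝ] E} (hT : T.IsSymmetric)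
    {n : ℕ} (hn : Module.finrank ℝ E = n) (x : E) :
    inner ℝ x (T x) =
      ∑ i, hT.eigenvalues hn i * inner ℝ (hT.eigenvectorBasis hn i) x ^ 2 := by
  rw [← (hT.eigenvectorBasis hn).sum_inner_mul_inner x (T x)]
  refine Finset.sum_congr rfl fun i _ => ?_
  rw [← hT, hT.apply_eigenvectorBasis, real_inner_comm]
  simp only [RCLike.ofReal_real_eq_id, id_eq, inner_smul_left, conj_trivial]
  ring

/-- Weyl's inequality: if the quadratic form of `T` exceeds that of `S` by at most `d ‖x‖²`, then
the ordered eigenvalues of `T` exceed those of `S` by at most `d`. -/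
theorem LinearMap.IsSymmetric.eigenvalues_le_add {T S : E →ₗ[ℝ] E} (hT : T.IsSymmetric)
    (hS : S.IsSymmetric) {n : ℕ} (hn : Module.finrank ℝ E = n) {d : ℝ}
    (h : ∀ x, inner ℝ x (T x) ≤ inner ℝ x (S x) + d * ‖x‖ ^ 2) (k : Fin n) :
    hT.eigenvalues hn k ≤ hS.eigenvalues hn k + d := by
  -- Only `n - 1` conditions in dimension `n`, so some `x ≠ 0` is orthogonal to the eigenvectors of
  -- `S` before `k` and those of `T` after `k`.
  let f : E →ₗ[ℝ] ({i : Fin n // i ≠ k} → ℝ) := LinearMap.pi fun i =>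
    if i.1 < k then (innerSL ℝ (hS.eigenvectorBasis hn i)).toLinearMap
    else (innerSL ℝ (hT.eigenvectorBasis hn i)).toLinearMap
  have hf : LinearMap.ker f ≠ ⊥ := by
    apply LinearMap.ker_ne_bot_of_finrank_lt
    have := k.pos
    simp only [Module.finrank_fintype_fun_eq_card, hn, ne_eq, Fintype.card_subtype_compl,
      Fintype.card_fin, Fintype.card_unique]
    omega
  obtain ⟨x, hx, hx0⟩ := Submodule.exists_mem_ne_zero_of_ne_bot hf
  have hfx : ∀ i : {i : Fin n // i ≠ k}, f x i = 0 := fun i => by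
    rw [LinearMap.mem_ker.1 hx]; rfl
  have hSx : ∀ i < k, inner ℝ (hS.eigenvectorBasis hn i) x = 0 := fun i hi => by
    simpa [f, hi] using hfx ⟨i, hi.ne⟩
  have hTx : ∀ i, k < i → inner ℝ (hT.eigenvectorBasis hn i) x = 0 := fun i hi => by
    simpa [f, hi.not_gt] using hfx ⟨i, hi.ne'⟩
  have h1 : hT.eigenvalues hn k * ‖x‖ ^ 2 ≤ inner ℝ x (T x) := by
    rw [hT.inner_apply_self_eq_sum hn, ← (hT.eigenvectorBasis hn).sum_sq_inner_right x,
      Finset.mul_sum]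
    refine Finset.sum_le_sum fun i _ => ?_
    rcases le_or_gt i k with hi | hi
    · exact mul_le_mul_of_nonneg_right (hT.eigenvalues_antitone hn hi) (sq_nonneg _)
    · simp [hTx i hi]
  have h2 : inner ℝ x (S x) ≤ hS.eigenvalues hn k * ‖x‖ ^ 2 := by
    rw [hS.inner_apply_self_eq_sum hn, ← (hS.eigenvectorBasis hn).sum_sq_inner_right x,
      Finset.mul_sum]
    refine Finset.sum_le_sum fun i _ => ?_
    rcases lt_or_ge i k with hi | hi
    · simp [hSx i hi]
    · exact mul_le_mul_of_nonneg_right (hS.eigenvalues_antitone hn hi) (sq_nonneg _)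
  have h3 : 0 < ‖x‖ ^ 2 := by positivity
  nlinarith [h x]

end Weyl

/-- Weyl's perturbation bound for the ordered eigenvalues of real symmetric matrices. -/
theorem abs_eigenvalues₀_sub_le {n : ℕ} {A B : Matrix (Fin n) (Fin n) ℝ} (hA : A.IsHermitian)
    (hB : B.IsHermitian) (k : Fin (Fintype.card (Fin n))) :
    |hB.eigenvalues₀ k - hA.eigenvalues₀ k| ≤ spectralNorm₂ (A - B) := by
  have key : ∀ x : EuclideanSpace ℝ (Fin n),
      |inner ℝ x (A.toEuclideanLin x) - inner ℝ x (B.toEuclideanLin x)|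
        ≤ spectralNorm₂ (A - B) * ‖x‖ ^ 2 := fun x => by
    have : inner ℝ x (A.toEuclideanLin x) - inner ℝ x (B.toEuclideanLin x)
        = inner ℝ x (Matrix.toEuclideanCLM (𝕜 := ℝ) (A - B) x) := by
      rw [← inner_sub_right, map_sub]; rfl
    rw [this]
    calc _ ≤ ‖x‖ * ‖Matrix.toEuclideanCLM (𝕜 := ℝ) (A - B) x‖ := abs_real_inner_le_norm _ _
      _ ≤ ‖x‖ * (spectralNorm₂ (A - B) * ‖x‖) := by
        gcongr; exact ContinuousLinearMap.le_opNorm _ _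
      _ = _ := by ring
  rw [abs_le]
  constructor
  · have := LinearMap.IsSymmetric.eigenvalues_le_add
      (Matrix.isSymmetric_toEuclideanLin_iff.mpr hA) (Matrix.isSymmetric_toEuclideanLin_iff.mpr hB)
      finrank_euclideanSpace (d := spectralNorm₂ (A - B))
      (fun x => by linarith [(abs_le.1 (key x)).2]) k
    simp only [Matrix.IsHermitian.eigenvalues₀]
    linarith
  · have := LinearMap.IsSymmetric.eigenvalues_le_add
      (Matrix.isSymmetric_toEuclideanLin_iff.mpr hB) (Matrix.isSymmetric_toEuclideanLin_iff.mpr hA)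
      finrank_euclideanSpace (d := spectralNorm₂ (A - B))
      (fun x => by linarith [(abs_le.1 (key x)).1]) k
    simp only [Matrix.IsHermitian.eigenvalues₀]
    linarith

/-! ### Spectral norm and trace moments -/

-- Unitary conjugation preserves the operator norm. The norm on the right is the sup norm on `Fin n
-- → ℝ`.
open scoped Matrix.Norms.L2Operator in
theorem spectralNorm₂_eq_norm_eigenvalues {n : ℕ} {X : Matrix (Fin n) (Fin n) ℝ}
    (hX : X.IsHermitian) : spectralNorm₂ X = ‖hX.eigenvalues‖ := by
  change ‖X‖ = _
  conv_lhs => rw [hX.spectral_theorem, Unitary.conjStarAlgAut_apply]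
  rw [← Unitary.coe_star, CStarRing.norm_mul_coe_unitary, CStarRing.norm_coe_unitary_mul,
    Matrix.l2_opNorm_diagonal]
  rfl

theorem Matrix.IsHermitian.trace_pow_eq_sum {n : ℕ} {X : Matrix (Fin n) (Fin n) ℝ}
    (hX : X.IsHermitian) (m : ℕ) : (X ^ m).trace = ∑ i, hX.eigenvalues i ^ m := by
  conv_lhs => rw [hX.spectral_theorem, ← map_pow, Unitary.conjStarAlgAut_apply,
    Matrix.trace_mul_comm, ← mul_assoc]
  simp [Matrix.diagonal_pow, Matrix.trace_diagonal]

/-- The even moments of the eigenvalues dominate the powers of the spectral norm. -/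
theorem spectralNorm₂_pow_le_trace {n : ℕ} [NeZero n] {X : Matrix (Fin n) (Fin n) ℝ}
    (hX : X.IsHermitian) (k : ℕ) : spectralNorm₂ X ^ (2 * k) ≤ (X ^ (2 * k)).trace := by
  rw [hX.trace_pow_eq_sum, spectralNorm₂_eq_norm_eigenvalues hX]
  obtain ⟨i, hi⟩ := Finite.exists_max fun i => ‖hX.eigenvalues i‖
  rw [((pi_norm_le_iff_of_nonempty _).2 hi).antisymm (norm_le_pi_norm _ i),
    Real.norm_eq_abs, pow_mul, sq_abs, ← pow_mul]
  exact Finset.single_le_sum (f := fun i => hX.eigenvalues i ^ (2 * k))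
    (fun i _ => by rw [pow_mul]; positivity) (Finset.mem_univ i)

/-! ### Combinatorics of paths -/

section Paths

variable {V : Type*} [DecidableEq V]

/-- Entries of a matrix power as a sum over paths. -/
theorem Matrix.pow_apply_eq_sum_paths [Fintype V] {R : Type*} [CommSemiring R]
    (X : Matrix V V R) (m : ℕ) (i j : V) :
    (X ^ m) i j = ∑ w : Fin (m + 1) → V with w 0 = i ∧ w (Fin.last m) = j,
      ∏ t : Fin m, X (w t.castSucc) (w t.succ) := by
  induction m generalizing i with
  | zero =>
    rw [Finset.sum_filter, ← (Equiv.funUnique (Fin 1) V).symm.sum_comp]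
    simp [Matrix.one_apply, Finset.filter_and, Finset.filter_eq']
    split_ifs <;> simp_all
  | succ m ih =>
    rw [pow_succ', Matrix.mul_apply, Finset.sum_filter,
      ← (Fin.consEquiv (fun _ : Fin (m + 2) => V)).sum_comp, Fintype.sum_prod_type_right]
    simp only [ih, Finset.sum_filter, Fin.consEquiv, Equiv.coe_fn_mk, Fin.cons_zero,
      ← Fin.succ_last, Fin.cons_succ, Fin.prod_univ_succ, Fin.castSucc_zero,
      ← Fin.succ_castSucc, ite_and, Finset.mul_sum]
    rw [Finset.sum_comm]
    refine Finset.sum_congr rfl fun w _ => ?_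
    simp

/-- The number of distinct vertices on a path. -/
def numVertices {m : ℕ} (w : Fin m → V) : ℕ := (Finset.univ.image w).card

/-- The set of undirected edges traversed by a path. -/
def pathEdges {m : ℕ} (w : Fin (m + 1) → V) : Finset (Sym2 V) :=
  Finset.univ.image fun t : Fin m => s(w t.castSucc, w t.succ)

theorem image_cons_eq_insert {m : ℕ} (i : V) (w : Fin m → V) :
    Finset.univ.image (Fin.cons i w : Fin (m + 1) → V) = insert i (Finset.univ.image w) := by
  ext x; simp [Fin.exists_fin_succ, eq_comm]

theorem pathEdges_cons {m : ℕ} (i : V) (w : Fin (m + 1) → V) :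
    pathEdges (Fin.cons i w : Fin (m + 2) → V) = insert s(i, w 0) (pathEdges w) := by
  ext x
  simp only [pathEdges, Finset.mem_image, Finset.mem_univ, true_and, Finset.mem_insert,
    Fin.exists_fin_succ, Fin.castSucc_zero, Fin.cons_zero, ← Fin.succ_castSucc, Fin.cons_succ]
  simp [eq_comm]

/-- A path is connected, so it visits at most one vertex more than it has edges. -/
theorem numVertices_le_card_pathEdges {m : ℕ} (w : Fin (m + 1) → V) :
    numVertices w ≤ (pathEdges w).card + 1 := by
  induction m with
  | zero => simp [numVertices]
  | succ m ih =>
    rw [← Fin.cons_self_tail w]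
    generalize w 0 = i
    generalize Fin.tail w = u
    have := ih u
    rw [numVertices, image_cons_eq_insert, pathEdges_cons]
    by_cases hi : i ∈ Finset.univ.image u
    · rw [Finset.insert_eq_of_mem hi]
      have := Finset.card_le_card (Finset.subset_insert s(i, u 0) (pathEdges u))
      unfold numVertices at *
      omega
    · have he : s(i, u 0) ∉ pathEdges u := fun h => by
        simp only [pathEdges, Finset.mem_image, Finset.mem_univ, true_and] at h
        obtain ⟨t, ht⟩ := h
        have : i ∈ s(u t.castSucc, u t.succ) := ht ▸ Sym2.mem_mk_left _ _
        rcases Sym2.mem_iff.1 this with h | h <;> exact hi (h ▸ by simp)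
      rw [Finset.card_insert_of_notMem hi, Finset.card_insert_of_notMem he]
      unfold numVertices at this
      omega

theorem numVertices_le {m : ℕ} (w : Fin m → V) : numVertices w ≤ m := by
  simpa [numVertices] using Finset.card_image_le (s := Finset.univ) (f := w)

theorem numVertices_pos {m : ℕ} (w : Fin (m + 1) → V) : 0 < numVertices w :=
  Finset.card_pos.2 ⟨w 0, by simp⟩

/-- Paths counted with weight `a` for each step to a new vertex and `b` for each other step. -/
theorem sum_paths_weight_le [Fintype V] {a b : ℝ} (ha : 0 ≤ a) (hb : 0 ≤ b)
    {M : ℕ} (m : ℕ) (hm : m ≤ M) :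
    ∑ w : Fin (m + 1) → V, a ^ (numVertices w - 1) * b ^ (m - (numVertices w - 1)) ≤
      Fintype.card V * (a * Fintype.card V + b * M) ^ m := by
  induction m with
  | zero =>
    have h : ∀ w : Fin 1 → V, numVertices w - 1 = 0 := fun w => by
      have := numVertices_le w; omega
    simp [h]
  | succ m ih =>
    rw [← (Fin.consEquiv (fun _ : Fin (m + 2) => V)).sum_comp, Fintype.sum_prod_type_right,
      pow_succ, ← mul_assoc]
    refine le_trans ?_ (mul_le_mul_of_nonneg_right (ih (by omega)) (by positivity))
    rw [Finset.sum_mul]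
    refine Finset.sum_le_sum fun w _ => ?_
    simp only [Fin.consEquiv, Equiv.coe_fn_mk]
    have hpos := numVertices_pos w
    have hle := numVertices_le w
    set v := numVertices w with hv
    -- The factor `a` is granted to every `i`, old or new; the at most `M` old vertices contribute
    -- `b` on top.
    have hterm : ∀ i : V, a ^ (numVertices (Fin.cons i w : Fin (m + 2) → V) - 1) *
        b ^ (m + 1 - (numVertices (Fin.cons i w : Fin (m + 2) → V) - 1)) ≤
        a ^ (v - 1) * b ^ (m - (v - 1)) * (a + if i ∈ Finset.univ.image w then b else 0) := by
      intro i
      by_cases hi : i ∈ Finset.univ.image w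
      · have e : numVertices (Fin.cons i w : Fin (m + 2) → V) = v := by
          rw [numVertices, image_cons_eq_insert, Finset.insert_eq_of_mem hi, hv, numVertices]
        have e2 : m + 1 - (v - 1) = (m - (v - 1)) + 1 := by omega
        rw [e, e2, if_pos hi, pow_succ, ← mul_assoc]
        gcongr
        linarith
      · have e : numVertices (Fin.cons i w : Fin (m + 2) → V) = v + 1 := by
          rw [numVertices, image_cons_eq_insert, Finset.card_insert_of_notMem hi, hv, numVertices]
        have e2 : m + 1 - (v + 1 - 1) = m - (v - 1) := by omega
        have e3 : v + 1 - 1 = (v - 1) + 1 := by omega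
        rw [e, e2, e3, if_neg hi, pow_succ, add_zero]
        exact le_of_eq (by ring)
    refine (Finset.sum_le_sum fun i _ => hterm i).trans ?_
    rw [← Finset.mul_sum]
    gcongr
    rw [Finset.sum_add_distrib, ← Finset.sum_filter, Finset.sum_const, Finset.sum_const]
    simp only [Finset.card_univ, nsmul_eq_mul, Finset.filter_mem_eq_inter, Finset.univ_inter]
    have : ((Finset.univ.image w).card : ℝ) ≤ M := by
      exact_mod_cast hle.trans hm
    nlinarith

end Paths

/-! ### Moments of the centred entries -/

section Moments

variable {Ω : Type*} [MeasurableSpace Ω] {P : Measure Ω}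

/-- Moments of a product of independent centred variables with sparse-type moment growth: a
factor occurring only once kills the expectation, and repeated occurrences save powers of `q`. -/
theorem abs_integral_prod_le [IsProbabilityMeasure P] {ι : Type*} [Fintype ι]
    [DecidableEq ι] {Y : ι → Ω → ℝ} (hY : iIndepFun Y P) (hm : ∀ e, Measurable (Y e)) {q : ℝ}
    (h0 : ∀ e, ∫ ω, Y e ω ∂P = 0)
    (hmom : ∀ e m, |∫ ω, Y e ω ^ (m + 1) ∂P| ≤ q ^ m) {m : ℕ} (g : Fin m → ι) :
    ∫ ω, ∏ t, Y (g t) ω ∂P = 0 ∨ 2 * (Finset.univ.image g).card ≤ m ∧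
      |∫ ω, ∏ t, Y (g t) ω ∂P| ≤ q ^ (m - (Finset.univ.image g).card) := by
  classical
  set N : ι → ℕ := fun e => (Finset.univ.filter fun t => g t = e).card with hN
  have hprod : ∀ ω, ∏ t, Y (g t) ω = ∏ e, Y e ω ^ N e := fun ω =>
    (Finset.prod_fiberwise' Finset.univ g (fun e => Y e ω)).symm.trans (by simp [hN])
  have hint : ∫ ω, ∏ t, Y (g t) ω ∂P = ∏ e, ∫ ω, Y e ω ^ N e ∂P := by
    simp_rw [hprod]
    exact hY.integral_fun_prod_comp (f := fun e x => x ^ N e) (fun e => (hm e).aemeasurable)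
      fun e => (measurable_id.pow_const _).aestronglyMeasurable
  have hNpos : ∀ e, e ∈ Finset.univ.image g ↔ 0 < N e := fun e => by
    simp [hN, Finset.card_pos, Finset.filter_nonempty_iff]
  have hsum : ∑ e ∈ Finset.univ.image g, N e = m := by
    have := Finset.card_eq_sum_card_image g (Finset.univ : Finset (Fin m))
    simpa [hN] using this.symm
  by_cases h1 : ∃ e, N e = 1
  · obtain ⟨e, he⟩ := h1
    left
    rw [hint]
    exact Finset.prod_eq_zero (Finset.mem_univ e) (by simp [he, h0])
  · right
    push Not at h1
    constructor
    · calc 2 * (Finset.univ.image g).card = ∑ e ∈ Finset.univ.image g, 2 := by simp [mul_comm]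
        _ ≤ ∑ e ∈ Finset.univ.image g, N e := Finset.sum_le_sum fun e he => by
            have := (hNpos e).1 he
            have := h1 e
            omega
        _ = m := hsum
    -- Each edge saves one power of `q`, matching the exponent `m` for the moment of order `m + 1`.
    · have hs : m - (Finset.univ.image g).card = ∑ e ∈ Finset.univ.image g, (N e - 1) := by
        have : ∑ e ∈ Finset.univ.image g, (N e - 1 + 1) = m := by
          refine Eq.trans ?_ hsum
          exact Finset.sum_congr rfl fun e he => by
            have := (hNpos e).1 he
            omega
        rw [Finset.sum_add_distrib, Finset.sum_const, smul_eq_mul, mul_one] at this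
        omega
      rw [hint, Finset.abs_prod, hs, ← Finset.prod_pow_eq_pow_sum,
        ← Finset.prod_subset (Finset.subset_univ (Finset.univ.image g))]
      · refine Finset.prod_le_prod (fun _ _ => abs_nonneg _) fun e he => ?_
        obtain ⟨k, hk⟩ : ∃ k, N e = k + 1 := ⟨N e - 1, by have := (hNpos e).1 he; omega⟩
        rw [hk]
        exact hmom e k
      · intro e _ he
        have : N e = 0 := by rw [hNpos] at he; omega
        simp [this]

variable {n : ℕ} {A : Matrix (Fin n) (Fin n) ℝ} {p : unitInterval}
  {C : Ω → Matrix (Fin n) (Fin n) ℝ}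

theorem IsEntrywiseSample.integral_pow (h : IsEntrywiseSample P A p C) {i j : Fin n}
    (hij : i < j) (m : ℕ) :
    ∫ ω, (A i j - C ω i j) ^ m ∂P =
      p * (A i j * (1 - 1 / p)) ^ m + (1 - p) * A i j ^ m := by
  have := (h.law i j hij).integral_comp (f := fun x => (A i j - x) ^ m)
    (by fun_prop)
  rw [integral_bernoulliMeasure] at this
  simp only [Function.comp_def, smul_eq_mul, sub_zero] at this
  rw [this, mul_sub, mul_one, mul_comm (A i j)]

theorem IsEntrywiseSample.integral_sub_eq_zero (h : IsEntrywiseSample P A p C) (hp : 0 < (p : ℝ))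
    {i j : Fin n} (hij : i < j) : ∫ ω, (A i j - C ω i j) ∂P = 0 := by
  have := h.integral_pow hij 1
  simp only [pow_one] at this
  rw [this]
  field_simp
  ring

/-- The large value has size at most `q = 1 / p` but probability `p`, so `p * q = 1` absorbs one of
the `m + 1` powers. For `m = 0` centring is used. -/
theorem IsEntrywiseSample.abs_integral_pow_le (h : IsEntrywiseSample P A p C)
    (hp : 0 < (p : ℝ)) {i j : Fin n} (hij : i < j) (hA : |A i j| ≤ 1) (m : ℕ) :
    |∫ ω, (A i j - C ω i j) ^ (m + 1) ∂P| ≤ (1 / (p : ℝ)) ^ m := by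
  rcases m with _ | m
  · simp [h.integral_sub_eq_zero hp hij]
  have hp1 : (p : ℝ) ≤ 1 := p.2.2
  rw [h.integral_pow hij]
  set q : ℝ := 1 / p with hq
  have hpq : (p : ℝ) * q = 1 := by rw [hq]; field_simp
  have hq1 : 1 ≤ q := by rw [hq, le_div_iff₀ hp]; linarith
  have hAm : |A i j| ^ (m + 1 + 1) ≤ 1 := pow_le_one₀ (abs_nonneg _) hA
  have hq0 : (0 : ℝ) ≤ (q - 1) ^ (m + 1 + 1) := pow_nonneg (by linarith) _
  calc _ ≤ |(p : ℝ) * (A i j * (1 - q)) ^ (m + 1 + 1)| + |(1 - p) * A i j ^ (m + 1 + 1)| :=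
        abs_add_le _ _
    _ = |A i j| ^ (m + 1 + 1) * (p * (q - 1) ^ (m + 1 + 1) + (1 - p)) := by
        rw [abs_mul, abs_mul, abs_pow, abs_pow, abs_mul, abs_of_pos hp, abs_sub_comm,
          abs_of_nonneg (sub_nonneg.2 hq1), abs_of_nonneg (sub_nonneg.2 hp1), mul_pow]
        ring
    _ ≤ 1 * (p * (q - 1) ^ (m + 1 + 1) + (1 - p)) := by
        gcongr
    -- Here `1 - p = p * (q - 1)`.
    _ ≤ p * ((q - 1) * q ^ (m + 1) + q ^ (m + 1)) := by
        have h1 : (q - 1) ^ (m + 1) ≤ q ^ (m + 1) :=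
          pow_le_pow_left₀ (by linarith) (by linarith) _
        have h2 : (q - 1) ^ (m + 1 + 1) ≤ (q - 1) * q ^ (m + 1) := by
          rw [pow_succ' (q - 1)]
          exact mul_le_mul_of_nonneg_left h1 (by linarith)
        have h3 : q ≤ q ^ (m + 1) := le_self_pow₀ hq1 (by omega)
        nlinarith
    _ = (p * q) * q ^ (m + 1) := by ring
    _ = q ^ (m + 1) := by rw [hpq, one_mul]

/-- Serves only for integrability of the path products. -/
theorem IsEntrywiseSample.ae_abs_sub_le (h : IsEntrywiseSample P A p C)
    (hAs : A.IsHermitian) (hA : ∀ i j, |A i j| ≤ 1) :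
    ∀ᵐ ω ∂P, ∀ i j, |A i j - C ω i j| ≤ 1 + 1 / (p : ℝ) := by
  have hp : (0 : ℝ) ≤ p := p.2.1
  have hp' : (0 : ℝ) ≤ 1 / p := by positivity
  have hlt : ∀ᵐ ω ∂P, ∀ i j, i < j → |A i j - C ω i j| ≤ 1 + 1 / (p : ℝ) := by
    simp only [ae_all_iff]
    intro i j hij
    have hmeas : MeasurableSet {x : ℝ | |A i j - x| ≤ 1 + 1 / (p : ℝ)} :=
      measurableSet_le (by fun_prop) measurable_const
    refine ((h.law i j hij).ae_iff hmeas.mem).2 ?_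
    have h1 : |A i j - 1 / p * A i j| ≤ 1 + 1 / (p : ℝ) := by
      refine (abs_sub _ _).trans ?_
      rw [abs_mul, abs_of_nonneg hp']
      exact add_le_add (hA i j) (mul_le_of_le_one_right hp' (hA i j))
    have h2 : |A i j - 0| ≤ 1 + 1 / (p : ℝ) := by
      rw [sub_zero]; linarith [hA i j]
    rw [bernoulliMeasure_def, ae_add_measure_iff]
    exact ⟨Measure.ae_smul_measure ((ae_dirac_iff hmeas).2 h1) _,
      Measure.ae_smul_measure ((ae_dirac_iff hmeas).2 h2) _⟩
  filter_upwards [hlt] with ω hω i j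
  rcases lt_trichotomy i j with hij | rfl | hij
  · exact hω i j hij
  · simp only [h.diag, sub_self, abs_zero]; positivity
  · have hAij : A i j = A j i := by simpa using hAs.apply j i
    rw [hAij, h.symm ω j i]
    exact hω j i hij

end Moments

/-! ### Trace moments and the tail bound -/

section Trace

variable {Ω : Type*} [MeasurableSpace Ω] {P : Measure Ω} {n : ℕ}
  {A : Matrix (Fin n) (Fin n) ℝ} {p : unitInterval}
  {C : Ω → Matrix (Fin n) (Fin n) ℝ}

theorem IsEntrywiseSample.sub_apply_comm (h : IsEntrywiseSample P A p C) (hA : A.IsHermitian)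
    (ω : Ω) (i j : Fin n) : (A - C ω) i j = (A - C ω) j i := by
  have hAij : A i j = A j i := by simpa using hA.apply j i
  rw [Matrix.sub_apply, Matrix.sub_apply, hAij, h.symm]

/-- Expected weight of a path in the centred sampling matrix. -/
theorem IsEntrywiseSample.abs_integral_path_le [IsProbabilityMeasure P]
    (h : IsEntrywiseSample P A p C)
    (hA : A.IsHermitian) (hA1 : ∀ i j, |A i j| ≤ 1) (hp : 0 < (p : ℝ)) {m : ℕ}
    (w : Fin (m + 1) → Fin n) :
    ∫ ω, ∏ t : Fin m, (A - C ω) (w t.castSucc) (w t.succ) ∂P = 0 ∨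
      2 * (numVertices w - 1) ≤ m ∧
      |∫ ω, ∏ t : Fin m, (A - C ω) (w t.castSucc) (w t.succ) ∂P|
        ≤ (1 / (p : ℝ)) ^ (m - (numVertices w - 1)) := by
  by_cases hloop : ∃ t : Fin m, w t.castSucc = w t.succ
  · obtain ⟨t, ht⟩ := hloop
    left
    have : ∀ ω, ∏ t : Fin m, (A - C ω) (w t.castSucc) (w t.succ) = 0 := fun ω =>
      Finset.prod_eq_zero (Finset.mem_univ t) (by rw [ht, Matrix.sub_apply, h.diag, sub_self])
    simp only [this, integral_zero]
  push Not at hloop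
  let Y : {e : Fin n × Fin n // e.1 < e.2} → Ω → ℝ := fun e ω => A e.1.1 e.1.2 - C ω e.1.1 e.1.2
  -- Both directions of an edge are the same random variable, indexed by its increasing pair.
  have hstep : ∀ t : Fin m, ∃ e : {e : Fin n × Fin n // e.1 < e.2},
      s(e.1.1, e.1.2) = s(w t.castSucc, w t.succ) ∧
      ∀ ω, (A - C ω) (w t.castSucc) (w t.succ) = Y e ω := fun t => by
    rcases (hloop t).lt_or_gt with hlt | hlt
    · exact ⟨⟨(w t.castSucc, w t.succ), hlt⟩, rfl, fun ω => rfl⟩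
    · exact ⟨⟨(w t.succ, w t.castSucc), hlt⟩, Sym2.eq_swap, fun ω => h.sub_apply_comm hA ω _ _⟩
  choose g hg hgY using hstep
  have hq1 : 1 ≤ 1 / (p : ℝ) := by rw [le_div_iff₀ hp]; linarith [p.2.2]
  have hedges : numVertices w - 1 ≤ (Finset.univ.image g).card := by
    have h1 := numVertices_le_card_pathEdges w
    have h2 : pathEdges w = (Finset.univ.image g).image fun e => s(e.1.1, e.1.2) := by
      rw [Finset.image_image, pathEdges]
      exact Finset.image_congr fun t _ => (hg t).symm
    have h3 : (pathEdges w).card ≤ (Finset.univ.image g).card := h2 ▸ Finset.card_image_le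
    omega
  have hY : iIndepFun Y P :=
    h.indep.comp (fun e x => A e.1.1 e.1.2 - x) fun e => by fun_prop
  simp_rw [hgY]
  rcases abs_integral_prod_le hY (fun e => (h.measurable _ _).const_sub _)
    (fun e => h.integral_sub_eq_zero hp e.2)
    (fun e => h.abs_integral_pow_le hp e.2 (hA1 _ _)) g with h0 | ⟨h2, hle⟩
  · exact Or.inl h0
  · exact Or.inr ⟨by omega, hle.trans (pow_le_pow_right₀ hq1 (by omega))⟩

theorem IsEntrywiseSample.integrable_path [IsProbabilityMeasure P]
    (h : IsEntrywiseSample P A p C)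
    (hA : A.IsHermitian) (hA1 : ∀ i j, |A i j| ≤ 1) {m : ℕ} (w : Fin (m + 1) → Fin n) :
    Integrable (fun ω => ∏ t : Fin m, (A - C ω) (w t.castSucc) (w t.succ)) P := by
  refine Integrable.of_bound (C := (1 + 1 / (p : ℝ)) ^ m) ?_ ?_
  · exact (Finset.measurable_fun_prod _ fun t _ =>
      (h.measurable _ _).const_sub _).aestronglyMeasurable
  · filter_upwards [h.ae_abs_sub_le hA hA1] with ω hω
    rw [Real.norm_eq_abs, Finset.abs_prod]
    exact (Finset.prod_le_prod (fun _ _ => abs_nonneg _) fun t _ => hω _ _).trans (by simp)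

theorem trace_pow_eq_sum_paths (X : Matrix (Fin n) (Fin n) ℝ) (m : ℕ) :
    (X ^ m).trace = ∑ i, ∑ w : Fin (m + 1) → Fin n with w 0 = i ∧ w (Fin.last m) = i,
      ∏ t : Fin m, X (w t.castSucc) (w t.succ) :=
  Finset.sum_congr rfl fun i _ => Matrix.pow_apply_eq_sum_paths X m i i

theorem IsEntrywiseSample.integrable_trace_pow [IsProbabilityMeasure P]
    (h : IsEntrywiseSample P A p C)
    (hA : A.IsHermitian) (hA1 : ∀ i j, |A i j| ≤ 1) (m : ℕ) :
    Integrable (fun ω => ((A - C ω) ^ m).trace) P := by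
  simp_rw [trace_pow_eq_sum_paths]
  exact integrable_finsetSum _ fun i _ => integrable_finsetSum _ fun w _ =>
    h.integrable_path hA hA1 w

/-- The even trace moments of the centred sampling matrix. -/
theorem IsEntrywiseSample.integral_trace_pow_le [IsProbabilityMeasure P]
    (h : IsEntrywiseSample P A p C)
    (hA : A.IsHermitian) (hA1 : ∀ i j, |A i j| ≤ 1) (hp : 0 < (p : ℝ)) {k : ℕ} (hk : 0 < k)
    (hkn : k * (1 / (p : ℝ)) ≤ n) :
    ∫ ω, ((A - C ω) ^ (2 * k)).trace ∂P ≤ n * (9 * n * k * (1 / (p : ℝ))) ^ k := by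
  set q : ℝ := 1 / p with hq
  have hq0 : 0 < q := by positivity
  have hk0 : (0 : ℝ) < k := by exact_mod_cast hk
  have hn0 : (0 : ℝ) < n := lt_of_lt_of_le (by positivity) hkn
  -- Chosen so that `a * b = q` and `a * n = b * k`, which balances new and old steps. The
  -- hypothesis `hkn` is exactly what makes `q ≤ b`.
  set a := √(k * q / n) with ha
  set b := √(n * q / k) with hb
  have hab : a * b = q := by
    rw [ha, hb, ← Real.sqrt_mul (by positivity), show k * q / n * (n * q / k) = q ^ 2 by field_simp,
      Real.sqrt_sq hq0.le]
  have hqb : q ≤ b := Real.le_sqrt_of_sq_le (by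
    rw [le_div_iff₀ hk0]; nlinarith)
  have hsq : (a * n + b * (2 * k : ℕ)) ^ 2 = 9 * n * k * q := by
    have h1 : a ^ 2 = k * q / n := Real.sq_sqrt (by positivity)
    have h2 : b ^ 2 = n * q / k := Real.sq_sqrt (by positivity)
    have : (a * n + b * (2 * k : ℕ)) ^ 2
        = a ^ 2 * n ^ 2 + 4 * (a * b) * (n * k) + 4 * b ^ 2 * k ^ 2 := by push_cast; ring
    rw [this, h1, h2, hab]
    field_simp
    ring
  have hpath : ∀ w : Fin (2 * k + 1) → Fin n,
      |∫ ω, ∏ t : Fin (2 * k), (A - C ω) (w t.castSucc) (w t.succ) ∂P| ≤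
        a ^ (numVertices w - 1) * b ^ (2 * k - (numVertices w - 1)) := fun w => by
    rcases h.abs_integral_path_le hA hA1 hp w with h0 | ⟨h2, hle⟩
    · rw [h0, abs_zero]; positivity
    · refine hle.trans ?_
      generalize numVertices w - 1 = u at h2
      -- With `k = u + r`, `q ^ (u + 2 * r) ≤ (a * b) ^ u * b ^ (2 * r)`.
      obtain ⟨r, rfl⟩ : ∃ r, k = u + r := ⟨k - u, by omega⟩
      rw [show 2 * (u + r) - u = u + 2 * r by omega, pow_add b, ← mul_assoc, ← mul_pow, hab,
        pow_add, ← hq]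
      gcongr
  simp_rw [trace_pow_eq_sum_paths]
  rw [integral_finsetSum _ fun i _ => integrable_finsetSum _ fun w _ =>
    h.integrable_path hA hA1 w]
  simp_rw [integral_finsetSum _ fun w _ => h.integrable_path hA hA1 w]
  calc _ ≤ ∑ i, ∑ w : Fin (2 * k + 1) → Fin n with w 0 = i,
        |∫ ω, ∏ t : Fin (2 * k), (A - C ω) (w t.castSucc) (w t.succ) ∂P| := by
        -- After absolute values, the closing condition can be dropped.
        refine Finset.sum_le_sum fun i _ => (Finset.sum_le_sum fun w _ => le_abs_self _).trans ?_
        refine Finset.sum_le_sum_of_subset_of_nonneg ?_ fun _ _ _ => abs_nonneg _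
        exact Finset.monotone_filter_right _ fun w _ hw => hw.1
    _ = ∑ w : Fin (2 * k + 1) → Fin n,
        |∫ ω, ∏ t : Fin (2 * k), (A - C ω) (w t.castSucc) (w t.succ) ∂P| :=
        Finset.sum_fiberwise _ _ _
    _ ≤ ∑ w : Fin (2 * k + 1) → Fin n,
        a ^ (numVertices w - 1) * b ^ (2 * k - (numVertices w - 1)) :=
        Finset.sum_le_sum fun w _ => hpath w
    _ ≤ n * (a * n + b * (2 * k : ℕ)) ^ (2 * k) := by
        simpa using sum_paths_weight_le (V := Fin n) (a := a) (b := b) (by positivity)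
          (by positivity) (2 * k) le_rfl
    _ = _ := by rw [pow_mul, hsq]

/-- Moment bound for the probability of a large spectral deviation. -/
theorem IsEntrywiseSample.measure_spectralNorm₂_gt_le [IsProbabilityMeasure P]
    (h : IsEntrywiseSample P A p C)
    (hA : A.IsHermitian) (hA1 : ∀ i j, |A i j| ≤ 1) (hp : 0 < (p : ℝ)) {k : ℕ} (hk : 0 < k)
    (hkn : k * (1 / (p : ℝ)) ≤ n) {s : ℝ} (hs : 0 < s) :
    P.real {ω | s < spectralNorm₂ (A - C ω)} ≤
      n * (9 * n * k * (1 / (p : ℝ)) / s ^ 2) ^ k := by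
  have hk0 : (0 : ℝ) < k := by exact_mod_cast hk
  have hn0 : (0 : ℝ) < n := lt_of_lt_of_le (by positivity) hkn
  have : NeZero n := ⟨by rintro rfl; simp at hn0⟩
  have hX : ∀ ω, (A - C ω).IsHermitian := fun ω => hA.sub (h.isHermitian ω)
  have hsub : {ω | s < spectralNorm₂ (A - C ω)} ⊆
      {ω | s ^ (2 * k) ≤ ((A - C ω) ^ (2 * k)).trace} := fun ω hω =>
    (pow_le_pow_left₀ hs.le (le_of_lt hω) _).trans (spectralNorm₂_pow_le_trace (hX ω) k)
  have hmarkov := mul_meas_ge_le_integral_of_nonneg (μ := P)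
    (f := fun ω => ((A - C ω) ^ (2 * k)).trace)
    (Filter.Eventually.of_forall fun ω =>
      le_trans (pow_nonneg (norm_nonneg _) _) (spectralNorm₂_pow_le_trace (hX ω) k))
    (h.integrable_trace_pow hA hA1 _) (s ^ (2 * k))
  have hle := hmarkov.trans (h.integral_trace_pow_le hA hA1 hp hk hkn)
  refine (measureReal_mono hsub).trans ?_
  rw [div_pow, ← pow_mul, ← mul_div_assoc, le_div_iff₀ (by positivity), mul_comm]
  exact hle

end Trace

/-! ### Choice of the moment -/

theorem theorem8 :
    ∃ c : ℝ, 0 < c ∧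
      ∀ (n : ℕ) (A : Matrix (Fin n) (Fin n) ℝ) (hA : A.IsHermitian)
        (_ : ∀ i j, |A i j| ≤ 1)
        (ε δ : ℝ) (_ : 0 < ε) (_ : ε < 1) (_ : 0 < δ) (_ : δ < 1)
        (p : unitInterval) (_ : c * Real.log (n / δ) / (n * ε ^ 2) ≤ (p : ℝ))
        {Ω : Type*} [MeasurableSpace Ω] (P : Measure Ω) [IsProbabilityMeasure P]
        (C : Ω → Matrix (Fin n) (Fin n) ℝ) (hC : IsEntrywiseSample P A p C),
        1 - δ ≤ P.real {ω | spectralNorm₂ (A - C ω) ≤ ε * n ∧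
          ∀ k : Fin (Fintype.card (Fin n)),
            |(hC.isHermitian ω).eigenvalues₀ k - hA.eigenvalues₀ k| ≤ ε * n} := by
  -- `81 = 3 * 27`: rounding gives `k ≤ 3 * l`, and `27 * k ≤ p * n * ε ^ 2` makes the base at most
  -- `1 / 3 ≤ exp (-1)`.
  refine ⟨81, by norm_num, ?_⟩
  intro n A hA hA1 ε δ hε hε1 hδ hδ1 p hcp Ω _ P _ C hC
  have hset : {ω | spectralNorm₂ (A - C ω) ≤ ε * n ∧ ∀ k : Fin (Fintype.card (Fin n)),
      |(hC.isHermitian ω).eigenvalues₀ k - hA.eigenvalues₀ k| ≤ ε * n} =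
      {ω | ε * n < spectralNorm₂ (A - C ω)}ᶜ := by
    ext ω
    simp only [Set.mem_ofPred_eq, Set.mem_compl_iff, not_lt]
    exact ⟨fun h => h.1,
      fun h => ⟨h, fun k => (abs_eigenvalues₀_sub_le hA (hC.isHermitian ω) k).trans h⟩⟩
  rw [hset]
  set S := {ω | ε * n < spectralNorm₂ (A - C ω)}
  suffices hS : P.real S ≤ δ by
    have h1 : P.real (S ∪ Sᶜ) ≤ P.real S + P.real Sᶜ := measureReal_union_le S Sᶜ
    rw [Set.union_compl_self, probReal_univ] at h1
    linarith
  -- For `n ≤ 1` nothing is sampled. For `n ≥ 2`, `l ≥ log 2 > 1 / 2` keeps the rounding loss within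
  -- the factor 3 and forces `p > 0`.
  rcases Nat.lt_or_ge n 2 with hn | hn
  · have hsub : Subsingleton (Fin n) := Fin.subsingleton_iff_le_one.2 (by omega)
    have hS : S = ∅ := by
      refine Set.eq_empty_of_forall_notMem fun ω hω => ?_
      have h0 : A - C ω = 0 := by
        ext i j
        rw [Subsingleton.elim j i, Matrix.sub_apply, hC.diag, sub_self, Matrix.zero_apply]
      have hω' : ε * n < spectralNorm₂ (A - C ω) := hω
      rw [h0, spectralNorm₂, map_zero, norm_zero] at hω'
      exact absurd hω' (not_lt.2 (by positivity))
    simp [hS, hδ.le]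
  have hn2 : (2 : ℝ) ≤ n := by exact_mod_cast hn
  have hn0 : (0 : ℝ) < n := by linarith
  set l := Real.log (n / δ) with hl
  have hnδ : 2 ≤ n / δ := by rw [le_div_iff₀ hδ]; nlinarith
  have hl2 : 1 / 2 < l := by
    have h1 := Real.log_le_log (by norm_num) hnδ
    have h2 := Real.log_two_gt_d9
    linarith
  set k := ⌈l⌉₊ with hk
  have hkl : l ≤ k := Nat.le_ceil l
  have hk3 : (k : ℝ) ≤ 3 * l := by
    have := Nat.ceil_lt_add_one (show 0 ≤ l by linarith)
    linarith
  have hk0 : 0 < k := Nat.ceil_pos.2 (by linarith)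
  have hp81 : 81 * l ≤ p * (n * ε ^ 2) := by rwa [div_le_iff₀ (by positivity)] at hcp
  have hp : 0 < (p : ℝ) := by
    by_contra hneg
    have := mul_nonpos_of_nonpos_of_nonneg (not_lt.1 hneg) (show 0 ≤ n * ε ^ 2 by positivity)
    linarith
  have hkp : 27 * (k : ℝ) ≤ p * (n * ε ^ 2) := by linarith
  have hkn : k * (1 / (p : ℝ)) ≤ n := by
    rw [mul_one_div, div_le_iff₀ hp]
    have : (p : ℝ) * (n * ε ^ 2) ≤ p * (n * 1) := by
      gcongr
      exact pow_le_one₀ hε.le hε1.le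
    linarith
  refine (hC.measure_spectralNorm₂_gt_le hA hA1 hp hk0 hkn (s := ε * n) (by positivity)).trans ?_
  have hbase : 9 * n * k * (1 / (p : ℝ)) / (ε * n) ^ 2 ≤ Real.exp (-1) := by
    have h1 : 9 * n * k * (1 / (p : ℝ)) / (ε * n) ^ 2 = 9 * k / (p * (n * ε ^ 2)) := by
      field_simp
    have h2 : 9 * (k : ℝ) / ((p : ℝ) * (n * ε ^ 2)) ≤ 1 / 3 := by
      rw [div_le_iff₀ (by positivity)]; linarith
    have h3 : 1 / 3 ≤ Real.exp (-1) := by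
      rw [Real.exp_neg, one_div]
      exact inv_anti₀ (Real.exp_pos _) (by linarith [Real.exp_one_lt_d9])
    linarith
  calc _ ≤ n * Real.exp (-1) ^ k := by gcongr
    _ ≤ n * Real.exp (-l) := by
        rw [← Real.exp_nat_mul]
        gcongr
        linarith
    _ = δ := by
        rw [Real.exp_neg, hl, Real.exp_log (by positivity)]
        field_simp
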